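/- Let $M$ be a paracompact $C^\infty$ manifold of finite dimension; all objects below are $C^\infty$. A vector $1$-form on $M$ is a section of $\mathrm{End}(TM)$, and the Frölicher–Nijenhuis bracket of two vector $1$-forms $K,N$ is the vector $2$-form $$[K,N](X,Y)=[KX,NY]+[NX,KY]+KN[X,Y]+NK[X,Y]-K[NX,Y]-K[X,NY]-N[KX,Y]-N[X,KY]$$ for all vector fields $X,Y$. Let $L$ be a vector $1$-form on $M$ such that $\frac12[L,L]=0$ and $\mathrm{Im}(L_z)=\mathrm{Ker}(L_z)$ for every $z\in M$ (so that $\dim M=2n$ is even and $L$ has constant rank $n$). Let $\Gamma$ be an $L$-connection on $M$, that is, a vector $1$-form with $L\Gamma=L$ and $\Gamma L=-L$. Put $h=\frac12(I+\Gamma)$, let $T=\frac12[L,\Gamma]$ be the torsion of $\Gamma$ and $R=-\frac12[h,h]$ its curvature, and let $F$ be the almost-complex structure associated to $\Gamma$, that is, the unique vector $1$-form with $FL=h$ and $Fh=-L$. Then the following assertions are equivalent: (a) $F$ is integrable, in the sense that $[F,F]=0$; (b) $T=0$ and $R=0$; (c) $[L,F]=0$; (d) $[h,F]=0$. -/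

import Mathlib

open scoped Manifold ContDiff Bundle

namespace LConn

noncomputable section

/-! ### Linear algebra in one tangent space -/

section Algebra

variable {V : Type*} [AddCommGroup V] [Module ℝ V]

theorem image_of_vertical {L Γ : V →ₗ[ℝ] V} (hL : ∀ x, L x = 0 ↔ ∃ y, L y = x)
    (h1 : ∀ x, L (Γ x) = L x) (x : V) : ∃ y, L y = x - Γ x := by
  rw [← hL, map_sub, h1, sub_self]

/-- Pointwise existence of the associated almost-complex structure. -/
theorem exists_pointwise (L Γ : V →ₗ[ℝ] V) (hL : ∀ x, L x = 0 ↔ ∃ y, L y = x)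
    (h1 : ∀ x, L (Γ x) = L x) (h2 : ∀ x, Γ (L x) = - L x) :
    ∃ F : V →ₗ[ℝ] V, (∀ x, F (L x) = (1 / 2 : ℝ) • (x + Γ x)) ∧
      (∀ x, F ((1 / 2 : ℝ) • (x + Γ x)) = - L x) := by
  obtain ⟨G', hG'⟩ := L.rangeRestrict.exists_rightInverse_of_surjective L.range_rangeRestrict
  obtain ⟨G, hG⟩ := G'.exists_extend
  have hLG : ∀ x, L (G (L x)) = L x := by
    intro x
    have a : G (L x) = G' (L.rangeRestrict x) := by
      rw [← hG]; rfl
    have b := LinearMap.congr_fun hG' (L.rangeRestrict x)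
    rw [a]
    exact congrArg Subtype.val b
  have hLL : ∀ x, L (L x) = 0 := fun x => (hL _).2 ⟨x, rfl⟩
  have hker : ∀ x, L x = 0 → x + Γ x = 0 := by
    intro x hx
    obtain ⟨y, rfl⟩ := (hL x).1 hx
    rw [h2, add_neg_cancel]
  have hΓ : ∀ x, Γ (Γ x) = x := by
    intro x
    have := hker (x - Γ x) (by rw [map_sub, h1, sub_self])
    rw [map_sub] at this
    have h3 : x - Γ (Γ x) = 0 := by rw [← this]; abel
    exact (sub_eq_zero.1 h3).symm
  refine ⟨((1 / 2 : ℝ) • (LinearMap.id + Γ)) ∘ₗ G ∘ₗ ((1 / 2 : ℝ) • (LinearMap.id - Γ)) - L,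
    fun x => ?_, fun x => ?_⟩
  · have e : (1 / 2 : ℝ) • (L x - Γ (L x)) = L x := by rw [h2]; module
    have k := hker (G (L x) - x) (by rw [map_sub, hLG, sub_self])
    rw [map_sub] at k
    have k' : G (L x) + Γ (G (L x)) = x + Γ x := by
      rw [← sub_eq_zero, ← k]; abel
    simp only [LinearMap.sub_apply, LinearMap.comp_apply, LinearMap.smul_apply,
      LinearMap.add_apply, LinearMap.id_apply, e, k', hLL, sub_zero]
  · have e : (1 / 2 : ℝ) • ((1 / 2 : ℝ) • (x + Γ x) - Γ ((1 / 2 : ℝ) • (x + Γ x))) = 0 := by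
      rw [map_smul, map_add, hΓ]; module
    have l : L ((1 / 2 : ℝ) • (x + Γ x)) = L x := by
      rw [map_smul, map_add, h1]; module
    rw [LinearMap.sub_apply, LinearMap.comp_apply, LinearMap.comp_apply, l, LinearMap.smul_apply,
      LinearMap.smul_apply, LinearMap.sub_apply, LinearMap.id_apply, e, map_zero, map_zero, smul_zero, zero_sub]

/-- Pointwise: `L F = v`, in the form `L F x + h x = x`. -/
theorem comp_pointwise {L Γ F : V →ₗ[ℝ] V} (hL : ∀ x, L x = 0 ↔ ∃ y, L y = x)
    (h1 : ∀ x, L (Γ x) = L x)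
    (hF1 : ∀ x, F (L x) = (1 / 2 : ℝ) • (x + Γ x))
    (hF2 : ∀ x, F ((1 / 2 : ℝ) • (x + Γ x)) = - L x) (x : V) :
    L (F x) + (1 / 2 : ℝ) • (x + Γ x) = x := by
  obtain ⟨y, hy⟩ := image_of_vertical hL h1 x
  have hLL : L (L x) = 0 := (hL _).2 ⟨x, rfl⟩
  have e : x = (1 / 2 : ℝ) • (x + Γ x) + (1 / 2 : ℝ) • L y := by rw [hy]; module
  have : L (F x) = (1 / 2 : ℝ) • L y := by
    conv_lhs => rw [e]
    rw [map_add, hF2, map_smul, hF1, map_add, map_neg, hLL, map_smul, map_smul, map_add, h1]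
    module
  rw [this, add_comm]; exact e.symm

/-- Pointwise uniqueness of the associated almost-complex structure. -/
theorem unique_pointwise {L Γ F F' : V →ₗ[ℝ] V} (hL : ∀ x, L x = 0 ↔ ∃ y, L y = x)
    (h1 : ∀ x, L (Γ x) = L x)
    (hF1 : ∀ x, F (L x) = (1 / 2 : ℝ) • (x + Γ x))
    (hF2 : ∀ x, F ((1 / 2 : ℝ) • (x + Γ x)) = - L x)
    (hF1' : ∀ x, F' (L x) = (1 / 2 : ℝ) • (x + Γ x))
    (hF2' : ∀ x, F' ((1 / 2 : ℝ) • (x + Γ x)) = - L x) (x : V) : F x = F' x := by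
  obtain ⟨y, hy⟩ := image_of_vertical hL h1 x
  have e : x = (1 / 2 : ℝ) • (x + Γ x) + (1 / 2 : ℝ) • L y := by rw [hy]; module
  rw [e, map_add, map_add, hF2, hF2', map_smul, map_smul, hF1, hF1']

end Algebra

/-! ### Vector fields and vector forms -/

variable (E : Type*) [NormedAddCommGroup E] [NormedSpace ℝ E]
variable (M : Type*) [TopologicalSpace M] [ChartedSpace E M] [IsManifold 𝓘(ℝ, E) ∞ M]

/-- The real vector space of `C^∞` vector fields on the manifold `M`. -/
abbrev VectorField : Type _ :=
  ContMDiffSection 𝓘(ℝ, E) E ∞ (fun x : M => TangentSpace 𝓘(ℝ, E) x)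

/-- The real vector space of vector `1`-forms on `M`: `C^∞` sections of the bundle
`End(TM)` of endomorphisms of the tangent bundle. -/
abbrev VectorOneForm : Type _ :=
  ContMDiffSection 𝓘(ℝ, E) (E →L[ℝ] E) ∞
    (fun x : M => TangentSpace 𝓘(ℝ, E) x →L[ℝ] TangentSpace 𝓘(ℝ, E) x)

variable {E M}

/-- The vector field `K X` obtained by applying a vector `1`-form `K` to a vector field `X`. -/
def app (K : VectorOneForm E M) (X : VectorField E M) : VectorField E M where
  toFun z := K z (X z)
  contMDiff_toFun := fun z => (K.contMDiff z).clm_bundle_apply (X.contMDiff z)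

/-- The Lie bracket `[X, Y]` of two `C^∞` vector fields. -/
def lie [FiniteDimensional ℝ E] (X Y : VectorField E M) : VectorField E M where
  toFun := VectorField.mlieBracket 𝓘(ℝ, E) X Y
  contMDiff_toFun := by
    have : CompleteSpace E := FiniteDimensional.complete ℝ E
    have : IsManifold 𝓘(ℝ, E) (((⊤ : ℕ∞) : WithTop ℕ∞) + 1) M := by
      simpa using (inferInstance : IsManifold 𝓘(ℝ, E) ∞ M)
    have : IsManifold 𝓘(ℝ, E) (minSmoothness ℝ 2) M := by
      rw [minSmoothness_of_isRCLikeNormedField]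
      infer_instance
    exact ContDiff.mlieBracket_vectorField (m := ⊤) (n := ⊤) X.contMDiff Y.contMDiff (by simp)

/-- The Frölicher–Nijenhuis bracket `[K, N]` of two vector `1`-forms. It is a vector `2`-form,
given here by its values on pairs of vector fields. -/
def fnBracket [FiniteDimensional ℝ E] (K N : VectorOneForm E M) :
    VectorField E M → VectorField E M → VectorField E M := fun X Y =>
  lie (app K X) (app N Y) + lie (app N X) (app K Y)
    + app K (app N (lie X Y)) + app N (app K (lie X Y))
    - app K (lie (app N X) Y) - app K (lie X (app N Y))
    - app N (lie (app K X) Y) - app N (lie X (app K Y))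

/-! ### Smoothness of endomorphism fields in coordinates -/

/-- Reading of an endomorphism of `T_z M` in the trivialization of `TM` around `x₀`. -/
def coord (x₀ z : M) (A : TangentSpace 𝓘(ℝ, E) z →L[ℝ] TangentSpace 𝓘(ℝ, E) z) : E →L[ℝ] E :=
  ContinuousLinearMap.inCoordinates E (TangentSpace 𝓘(ℝ, E) (M := M)) E
        (TangentSpace 𝓘(ℝ, E) (M := M)) x₀ z x₀ z A

theorem contMDiff_oneForm_iff
    (A : ∀ x : M, TangentSpace 𝓘(ℝ, E) x →L[ℝ] TangentSpace 𝓘(ℝ, E) x) (x₀ : M) :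
    ContMDiffAt 𝓘(ℝ, E) (𝓘(ℝ, E).prod 𝓘(ℝ, E →L[ℝ] E)) ∞
      (fun x => Bundle.TotalSpace.mk' (E →L[ℝ] E)
        (E := fun x : M => TangentSpace 𝓘(ℝ, E) x →L[ℝ] TangentSpace 𝓘(ℝ, E) x) x (A x)) x₀ ↔
    ContMDiffAt 𝓘(ℝ, E) 𝓘(ℝ, E →L[ℝ] E) ∞ (fun x => coord x₀ x (A x)) x₀ := by
  rw [contMDiffAt_hom_bundle]
  exact ⟨fun h => h.2, fun h => ⟨contMDiffAt_id, h⟩⟩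

/-- In a trivialization, `coord` is conjugation by a linear isomorphism. -/
theorem exists_coord_eq (x₀ : M) : ∀ᶠ z in nhds x₀,
    ∃ e : TangentSpace 𝓘(ℝ, E) z ≃L[ℝ] E, ∀ A u, coord x₀ z A u = e (A (e.symm u)) := by
  filter_upwards [(trivializationAt E (TangentSpace 𝓘(ℝ, E) (M := M)) x₀).open_baseSet.mem_nhds
    (FiberBundle.mem_baseSet_trivializationAt' x₀)] with z hz
  refine ⟨(trivializationAt E (TangentSpace 𝓘(ℝ, E) (M := M)) x₀).continuousLinearEquivAt ℝ z hz,
    fun A u => ?_⟩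
  rw [coord, ContinuousLinearMap.inCoordinates_eq hz hz]
  rfl

variable (E M) in
/-- The identity vector `1`-form `I`. -/
def one : VectorOneForm E M where
  toFun z := ContinuousLinearMap.id ℝ (TangentSpace 𝓘(ℝ, E) z)
  contMDiff_toFun := fun x₀ => by
    refine (contMDiff_oneForm_iff _ x₀).2 ?_
    refine (contMDiffAt_const (c := ContinuousLinearMap.id ℝ E)).congr_of_eventuallyEq ?_
    filter_upwards [exists_coord_eq (E := E) x₀] with z hz
    obtain ⟨e, he⟩ := hz
    ext u
    rw [he]
    simp

/-! ### `L`-connections -/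

/-- The standing assumptions on `L`: its Nijenhuis tensor `½[L, L]` vanishes and
`Im L_z = Ker L_z` at every point `z`. -/
structure IsAlmostTangent [FiniteDimensional ℝ E] (L : VectorOneForm E M) : Prop where
  nijenhuis : (1 / 2 : ℝ) • fnBracket L L = 0
  range_eq_ker : ∀ z : M, (L z).range = (L z).ker

/-- `Γ` is an `L`-connection: `L Γ = L` and `Γ L = -L`. -/
structure IsLConnection (L Γ : VectorOneForm E M) : Prop where
  comp_right : ∀ (z : M) (X : TangentSpace 𝓘(ℝ, E) z), L z (Γ z X) = L z X
  comp_left : ∀ (z : M) (X : TangentSpace 𝓘(ℝ, E) z), Γ z (L z X) = - L z X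

/-- The horizontal projector `h = ½(I + Γ)`. -/
def hor (Γ : VectorOneForm E M) : VectorOneForm E M := (1 / 2 : ℝ) • (one E M + Γ)

theorem hor_apply (Γ : VectorOneForm E M) (z : M) (X : TangentSpace 𝓘(ℝ, E) z) :
    hor Γ z X = (1 / 2 : ℝ) • (X + Γ z X) := rfl

/-- The torsion `T = ½[L, Γ]`. -/
def torsion [FiniteDimensional ℝ E] (L Γ : VectorOneForm E M) :
    VectorField E M → VectorField E M → VectorField E M :=
  (1 / 2 : ℝ) • fnBracket L Γ

/-- The curvature `R = -½[h, h]`. -/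
def curvature [FiniteDimensional ℝ E] (Γ : VectorOneForm E M) :
    VectorField E M → VectorField E M → VectorField E M :=
  -((1 / 2 : ℝ) • fnBracket (hor Γ) (hor Γ))

/-- The equations `F L = h` and `F h = -L` for a vector `1`-form `F`. -/
structure IsAssociated (L Γ F : VectorOneForm E M) : Prop where
  comp_L : ∀ (z : M) (X : TangentSpace 𝓘(ℝ, E) z), F z (L z X) = hor Γ z X
  comp_hor : ∀ (z : M) (X : TangentSpace 𝓘(ℝ, E) z), F z (hor Γ z X) = - L z X

theorem eq_zero_iff_of_range_eq_ker {L : VectorOneForm E M}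
    (h : ∀ z : M, (L z).range = (L z).ker) (z : M) (x : TangentSpace 𝓘(ℝ, E) z) :
    L z x = 0 ↔ ∃ y, L z y = x := by
  have := SetLike.ext_iff.1 (h z) x
  simpa using this.symm

theorem existsUnique_associated [FiniteDimensional ℝ E] {L Γ : VectorOneForm E M}
    (hL : IsAlmostTangent L) (hΓ : IsLConnection L Γ) :
    ∃! F : VectorOneForm E M, IsAssociated L Γ F := by
  have hk := eq_zero_iff_of_range_eq_ker hL.range_eq_ker
  have key : ∀ z : M, ∃ F : TangentSpace 𝓘(ℝ, E) z →L[ℝ] TangentSpace 𝓘(ℝ, E) z,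
      (∀ x, F (L z x) = hor Γ z x) ∧ (∀ x, F (hor Γ z x) = - L z x) := by
    intro z
    have : FiniteDimensional ℝ (TangentSpace 𝓘(ℝ, E) z) :=
      inferInstanceAs (FiniteDimensional ℝ E)
    have : T2Space (TangentSpace 𝓘(ℝ, E) z) := inferInstanceAs (T2Space E)
    obtain ⟨F, hF1, hF2⟩ := exists_pointwise (L z).toLinearMap (Γ z).toLinearMap (hk z)
      (hΓ.comp_right z) (hΓ.comp_left z)
    exact ⟨LinearMap.toContinuousLinearMap F, hF1, hF2⟩
  choose F hF1 hF2 using key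
  have hsmooth : ∀ x₀ : M, ContMDiffAt 𝓘(ℝ, E) 𝓘(ℝ, E →L[ℝ] E) ∞
      (fun x => coord x₀ x (F x)) x₀ := by
    intro x₀
    have : CompleteSpace E := FiniteDimensional.complete ℝ E
    have sL := (contMDiff_oneForm_iff _ x₀).1 (L.contMDiff x₀)
    have sh := (contMDiff_oneForm_iff _ x₀).1 ((hor Γ).contMDiff x₀)
    set C : E →L[ℝ] E := coord x₀ x₀ (F x₀) with hC
    set W : M → E →L[ℝ] E := fun x => (coord x₀ x (L x)).comp C + coord x₀ x (hor Γ x) with hW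
    have sW : ContMDiffAt 𝓘(ℝ, E) 𝓘(ℝ, E →L[ℝ] E) ∞ W x₀ :=
      (sL.clm_comp contMDiffAt_const).add sh
    have W0 : W x₀ = ContinuousLinearMap.id ℝ E := by
      obtain ⟨e, he⟩ := (exists_coord_eq (E := E) x₀).self_of_nhds
      ext u
      have := comp_pointwise (L := (L x₀).toLinearMap) (Γ := (Γ x₀).toLinearMap)
        (F := (F x₀).toLinearMap) (hk x₀) (hΓ.comp_right x₀) (hF1 x₀) (hF2 x₀) (e.symm u)
      simp only [hW, hC, add_apply, ContinuousLinearMap.comp_apply, he,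
        ContinuousLinearEquiv.symm_apply_apply, ← map_add]
      exact (congrArg e this).trans (e.apply_symm_apply u)
    have hinv : ContDiffAt ℝ ∞ (ContinuousLinearMap.inverse : (E →L[ℝ] E) → E →L[ℝ] E) (W x₀) := by
      rw [W0]
      exact contDiffAt_map_inverse (ContinuousLinearEquiv.refl ℝ E)
    have sinv : ContMDiffAt 𝓘(ℝ, E) 𝓘(ℝ, E →L[ℝ] E) ∞
        (fun x => ContinuousLinearMap.inverse (W x)) x₀ :=
      hinv.contMDiffAt.comp x₀ sW
    have evW : ∀ᶠ x in nhds x₀, (W x).IsInvertible := by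
      have o : IsOpen (Set.range ((↑) : (E ≃L[ℝ] E) → E →L[ℝ] E)) :=
        ContinuousLinearEquiv.isOpen
      exact sW.continuousAt.eventually_mem (o.mem_nhds ⟨ContinuousLinearEquiv.refl ℝ E, W0.symm⟩)
    have stot := ((sh.clm_comp (contMDiffAt_const (c := C))).sub sL).clm_comp sinv
    refine stot.congr_of_eventuallyEq ?_
    filter_upwards [evW, exists_coord_eq (E := E) x₀] with x hx hex
    obtain ⟨e, he⟩ := hex
    have eq1 : (coord x₀ x (F x)).comp (W x)
        = (coord x₀ x (hor Γ x)).comp C - coord x₀ x (L x) := by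
      ext u
      simp only [hW, add_apply, ContinuousLinearMap.comp_apply, he, map_add,
        ContinuousLinearEquiv.symm_apply_apply, sub_apply, hF1, hF2, map_neg]
      abel
    have eq2 : (W x).comp (ContinuousLinearMap.inverse (W x)) = ContinuousLinearMap.id ℝ E :=
      hx.self_comp_inverse
    change coord x₀ x (F x) = ((coord x₀ x (hor Γ x)).comp C - coord x₀ x (L x)).comp
      (ContinuousLinearMap.inverse (W x))
    rw [← eq1, ContinuousLinearMap.comp_assoc, eq2, ContinuousLinearMap.comp_id]
  refine ⟨⟨F, fun x₀ => (contMDiff_oneForm_iff _ x₀).2 (hsmooth x₀)⟩, ⟨hF1, hF2⟩, ?_⟩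
  intro F' hF'
  refine ContMDiffSection.ext fun z => ContinuousLinearMap.ext fun x => ?_
  exact unique_pointwise (L := (L z).toLinearMap) (Γ := (Γ z).toLinearMap)
    (F := (F' z).toLinearMap) (F' := (F z).toLinearMap) (hk z) (hΓ.comp_right z)
    (hF'.comp_L z) (hF'.comp_hor z) (hF1 z) (hF2 z) x

/-- The almost-complex structure associated to an `L`-connection `Γ`: the unique vector
`1`-form `F` with `F L = h` and `F h = -L`. -/
def almostComplex [FiniteDimensional ℝ E] {L Γ : VectorOneForm E M}
    (hL : IsAlmostTangent L) (hΓ : IsLConnection L Γ) : VectorOneForm E M :=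
  (existsUnique_associated hL hΓ).choose

theorem almostComplex_isAssociated [FiniteDimensional ℝ E] {L Γ : VectorOneForm E M}
    (hL : IsAlmostTangent L) (hΓ : IsLConnection L Γ) :
    IsAssociated L Γ (almostComplex hL hΓ) :=
  (existsUnique_associated hL hΓ).choose_spec.1

end

end LConn

/-! All four assertions are shown equivalent to one identity (*): `[hX, hY] = (F + L)([LX, hY] +
[hX, LY])` for all `X`, `Y`. The proof is pure algebra in the additive group of vector fields: it
uses biadditivity of the Lie bracket, the relations `IsAdapted`, and `[L, L] = 0`, which (as `Lh =
L`) reads `[LX, LY] = L([LX, hY] + [hX, LY])`. Evaluating each Frölicher–Nijenhuis bracket on a pair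
`(hX, hY)` yields (*). Conversely, since `X = hX + L(FX)`, a bracket vanishes once it does on pairs
of fields of the forms `hX` and `LX`; there `[L, L] = 0` and (*) reduce everything to mixed brackets
`[LX, hY]`, `[hX, LY]`, which cancel. -/

namespace LConn

/-! ### Algebra of a biadditive bracket -/

section Bracket

variable {V : Type*} [AddCommGroup V] (B : V →+ V →+ V)

/-- The Frölicher–Nijenhuis bracket of two endomorphisms of an additive group `V` with respect to
a biadditive bracket `B` on `V`. -/
def endBracket (K N : V →+ V) : V →+ V →+ V :=
  (B.compl₂ N).comp K + (B.compl₂ K).comp N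
    + B.compr₂ (K.comp N) + B.compr₂ (N.comp K)
    - (B.compr₂ K).comp N - (B.compr₂ K).compl₂ N
    - (B.compr₂ N).comp K - (B.compr₂ N).compl₂ K

theorem endBracket_apply (K N : V →+ V) (x y : V) :
    endBracket B K N x y = B (K x) (N y) + B (N x) (K y) + K (N (B x y)) + N (K (B x y))
      - K (B (N x) y) - K (B x (N y)) - N (B (K x) y) - N (B x (K y)) := rfl

/-- The algebraic relations between an almost tangent structure `L`, the horizontal projector `h`
of an `L`-connection and the associated almost-complex structure `F`. -/
structure IsAdapted (L h F : V →+ V) : Prop where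
  L_L : ∀ x, L (L x) = 0
  L_h : ∀ x, L (h x) = L x
  h_L : ∀ x, h (L x) = 0
  F_L : ∀ x, F (L x) = h x
  F_h : ∀ x, F (h x) = -L x
  L_F : ∀ x, L (F x) = x - h x

namespace IsAdapted

variable {B} {L h F : V →+ V} (H : IsAdapted L h F)
include H

theorem h_h (x : V) : h (h x) = h x := by
  have := H.L_F (h x)
  rw [H.F_h, map_neg, H.L_L, neg_zero] at this
  exact (sub_eq_zero.1 this.symm).symm

/-- Since `h = FL`, one has `hF = F(LF) = F(1 - h) = F + L`. -/
theorem h_F (x : V) : h (F x) = F x + L x := by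
  rw [← H.F_L, H.L_F, map_sub, H.F_h, sub_neg_eq_add]

theorem F_F (x : V) : F (F x) = -x := by
  have e : F x = h (F x) - L x := by rw [H.h_F, add_sub_cancel_right]
  rw [e, map_sub, H.F_h, H.L_F, H.F_L]
  abel

/-- The splitting `x = h x + L (F x)` holds in `V` itself, so additivity of `Φ` suffices and no
tensoriality is needed. -/
theorem eq_zero_of_split {Φ : V →+ V →+ V}
    (hh : ∀ x y, Φ (h x) (h y) = 0) (hl : ∀ x y, Φ (h x) (L y) = 0)
    (lh : ∀ x y, Φ (L x) (h y) = 0) (ll : ∀ x y, Φ (L x) (L y) = 0) (x y : V) : Φ x y = 0 := by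
  have e : ∀ x, x = h x + L (F x) := fun x => by rw [H.L_F]; abel
  rw [e x, e y]
  simp only [map_add, AddMonoidHom.add_apply, hh, hl, lh, ll, add_zero]

/-! ### Each condition reduced to the identity (*) -/

section Integrability

variable (B) (hB : ∀ x y, B (L x) (L y) = L (B (L x) (h y)) + L (B (h x) (L y)))
include hB

/-- With `b = B (h x) (h y)` and `m = B (L x) (h y) + B (h x) (L y)`, the value at `(h x, h y)` is
`-2(b - F m - L m)`; the factor 2 is why torsion-freeness enters. -/
theorem endBracket_self_eq_zero_iff [IsAddTorsionFree V] :
    (∀ x y, endBracket B F F x y = 0) ↔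
      ∀ x y, B (h x) (h y) = F (B (L x) (h y) + B (h x) (L y)) +
        L (B (L x) (h y) + B (h x) (L y)) := by
  constructor
  · intro k x y
    have k' := k (h x) (h y)
    simp only [endBracket_apply, H.F_h, map_neg, AddMonoidHom.neg_apply, neg_neg, hB, H.F_F] at k'
    have k2 : (2 : ℕ) • (B (h x) (h y) - (F (B (L x) (h y) + B (h x) (L y)) +
        L (B (L x) (h y) + B (h x) (L y)))) = (2 : ℕ) • (0 : V) := by
      rw [smul_zero, ← neg_eq_zero, ← k']
      simp only [map_add]
      abel
    exact sub_eq_zero.1 (nsmul_right_injective two_ne_zero k2)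
  · intro k
    -- `hB` eliminates the brackets of two `L`-terms and `k` those of two `h`-terms; the remaining
    -- mixed brackets cancel formally.
    refine H.eq_zero_of_split ?_ ?_ ?_ ?_ <;> intro x y <;>
    simp only [endBracket_apply, H.F_h, H.F_L, H.F_F,
      map_add, map_neg, AddMonoidHom.neg_apply, hB, k] <;> abel

theorem endBracket_L_F_eq_zero_iff :
    (∀ x y, endBracket B L F x y = 0) ↔
      ∀ x y, B (h x) (h y) = F (B (L x) (h y) + B (h x) (L y)) +
        L (B (L x) (h y) + B (h x) (L y)) := by
  constructor
  · intro k x y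
    have k' := k (h x) (h y)
    simp only [endBracket_apply, H.F_h, H.F_L, H.L_F, H.L_h, map_neg, AddMonoidHom.neg_apply,
      hB] at k'
    rw [← sub_eq_zero, ← k']
    simp only [map_add]
    abel
  · intro k
    refine H.eq_zero_of_split ?_ ?_ ?_ ?_ <;> intro x y <;>
    simp only [endBracket_apply, H.F_h, H.F_L, H.L_F, H.F_F, H.L_L, H.L_h,
      map_add, map_neg, map_sub, map_zero, AddMonoidHom.neg_apply, AddMonoidHom.zero_apply,
      hB, k] <;> abel

theorem endBracket_h_F_eq_zero_iff :
    (∀ x y, endBracket B h F x y = 0) ↔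
      ∀ x y, B (h x) (h y) = F (B (L x) (h y) + B (h x) (L y)) +
        L (B (L x) (h y) + B (h x) (L y)) := by
  constructor
  · intro k x y
    -- The value at `(h x, h y)` is `-(F b + m - h m)`, with `b` the bracket of `h x`, `h y` and `m`
    -- the sum of the mixed ones; applying `F`, where `F² = -1`, isolates `b`.
    have k' := congrArg F (k (h x) (h y))
    simp only [endBracket_apply, H.F_h, H.F_L, H.h_F, H.F_F, H.h_h, map_add,
      map_neg, map_sub, map_zero, AddMonoidHom.neg_apply] at k'
    rw [← sub_eq_zero, ← k']
    simp only [map_add]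
    abel
  · intro k
    refine H.eq_zero_of_split ?_ ?_ ?_ ?_ <;> intro x y <;>
    simp only [endBracket_apply, H.F_h, H.F_L, H.h_F, H.F_F, H.h_L, H.h_h,
      map_add, map_neg, map_zero, AddMonoidHom.neg_apply, AddMonoidHom.zero_apply,
      hB, k] <;> abel

/-- The two conditions share the work: at `(h x, h y)`, `F` applied to the bracket of `L` and `h`
prescribes `h (B (h x) (h y))`, while the bracket of `h` with itself says that `B (h x) (h y)` is
horizontal. -/
theorem endBracket_L_h_and_h_h_eq_zero_iff [IsAddTorsionFree V] :
    ((∀ x y, endBracket B L h x y = 0) ∧ ∀ x y, endBracket B h h x y = 0) ↔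
      ∀ x y, B (h x) (h y) = F (B (L x) (h y) + B (h x) (L y)) +
        L (B (L x) (h y) + B (h x) (L y)) := by
  constructor
  · rintro ⟨k₁, k₂⟩ x y
    have e₁ := congrArg F (k₁ (h x) (h y))
    have e₂ := k₂ (h x) (h y)
    simp only [endBracket_apply, H.F_h, H.F_L, H.L_h, H.h_L, H.h_h, map_add, map_sub,
      map_zero] at e₁ e₂
    have e₃ : (2 : ℕ) • (B (h x) (h y) - h (B (h x) (h y))) = (2 : ℕ) • (0 : V) := by
      rw [smul_zero, ← e₂]
      abel
    have e₄ := sub_eq_zero.1 (nsmul_right_injective two_ne_zero e₃)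
    rw [e₄, eq_comm, ← sub_eq_zero, ← e₁]
    simp only [map_add]
    abel
  · intro k
    constructor <;> refine H.eq_zero_of_split ?_ ?_ ?_ ?_ <;> intro x y <;>
    simp only [endBracket_apply, H.L_F, H.h_F, H.L_L, H.L_h, H.h_L, H.h_h,
      map_add, map_sub, map_zero, AddMonoidHom.zero_apply,
      hB, k] <;> abel

end Integrability

end IsAdapted

end Bracket

/-! ### Transfer to vector fields on the manifold -/

section Manifold

variable {E : Type*} [NormedAddCommGroup E] [NormedSpace ℝ E]
  {M : Type*} [TopologicalSpace M] [ChartedSpace E M] [IsManifold 𝓘(ℝ, E) ∞ M]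

theorem VectorField.mdifferentiableAt (X : VectorField E M) (z : M) :
    MDifferentiableAt 𝓘(ℝ, E) (𝓘(ℝ, E).prod 𝓘(ℝ, E))
      (fun x => Bundle.TotalSpace.mk' E (E := fun x : M => TangentSpace 𝓘(ℝ, E) x) x (X x)) z :=
  (X.contMDiff z).mdifferentiableAt (by simp)

/-- The action of a vector `1`-form on vector fields as an additive map. -/
noncomputable def appHom (K : VectorOneForm E M) : VectorField E M →+ VectorField E M :=
  AddMonoidHom.mk' (app K) fun X Y => ContMDiffSection.ext fun z => map_add (K z) (X z) (Y z)

variable [FiniteDimensional ℝ E]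

theorem lie_add_left (X X' Y : VectorField E M) : lie (X + X') Y = lie X Y + lie X' Y := by
  have : CompleteSpace E := FiniteDimensional.complete ℝ E
  exact ContMDiffSection.ext fun z =>
    _root_.VectorField.mlieBracket_add_left (X.mdifferentiableAt z) (X'.mdifferentiableAt z)

theorem lie_add_right (X Y Y' : VectorField E M) : lie X (Y + Y') = lie X Y + lie X Y' := by
  have : CompleteSpace E := FiniteDimensional.complete ℝ E
  exact ContMDiffSection.ext fun z =>
    _root_.VectorField.mlieBracket_add_right (Y.mdifferentiableAt z) (Y'.mdifferentiableAt z)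

/-- The Lie bracket of vector fields as a biadditive map. -/
noncomputable def lieHom : VectorField E M →+ VectorField E M →+ VectorField E M :=
  AddMonoidHom.mk' (fun X => AddMonoidHom.mk' (lie X) (lie_add_right X)) fun X X' =>
    AddMonoidHom.ext fun Y => lie_add_left X X' Y

theorem fnBracket_eq_endBracket (K N : VectorOneForm E M) (X Y : VectorField E M) :
    fnBracket K N X Y = endBracket lieHom (appHom K) (appHom N) X Y := rfl

theorem fnBracket_eq_zero_iff (K N : VectorOneForm E M) :
    fnBracket K N = 0 ↔ ∀ X Y, endBracket lieHom (appHom K) (appHom N) X Y = 0 := by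
  simp only [funext_iff, fnBracket_eq_endBracket, Pi.zero_apply]

theorem IsAlmostTangent.isAdapted {L Γ F : VectorOneForm E M} (hL : IsAlmostTangent L)
    (hΓ : IsLConnection L Γ) (hF : IsAssociated L Γ F) :
    IsAdapted (appHom L) (appHom (hor Γ)) (appHom F) := by
  have hk := eq_zero_iff_of_range_eq_ker hL.range_eq_ker
  refine ⟨?_, ?_, ?_, ?_, ?_, ?_⟩ <;> intro X <;> refine ContMDiffSection.ext fun z => ?_
  · exact (hk z _).2 ⟨X z, rfl⟩
  · change L z ((1 / 2 : ℝ) • (X z + Γ z (X z))) = L z (X z)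
    rw [map_smul, map_add, hΓ.comp_right]
    module
  · change (1 / 2 : ℝ) • (L z (X z) + Γ z (L z (X z))) = 0
    rw [hΓ.comp_left, add_neg_cancel, smul_zero]
  · exact hF.comp_L z (X z)
  · exact hF.comp_hor z (X z)
  · exact eq_sub_of_add_eq (comp_pointwise (L := (L z).toLinearMap) (Γ := (Γ z).toLinearMap)
      (F := (F z).toLinearMap) (hk z) (hΓ.comp_right z) (hF.comp_L z) (hF.comp_hor z) (X z))

theorem IsAlmostTangent.lie_app_app {L : VectorOneForm E M} (hL : IsAlmostTangent L)
    (X Y : VectorField E M) :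
    lie (app L X) (app L Y) = app L (lie (app L X) Y) + app L (lie X (app L Y)) := by
  have hLL : ∀ Z, app L (app L Z) = 0 := fun Z => ContMDiffSection.ext fun z =>
    (eq_zero_iff_of_range_eq_ker hL.range_eq_ker z _).2 ⟨Z z, rfl⟩
  have e := congrFun (congrFun hL.nijenhuis X) Y
  simp only [Pi.smul_apply, fnBracket, hLL, Pi.zero_apply] at e
  rw [← sub_eq_zero, ← e]
  module

/-- `Γ = 2h - I`, and the bracket of `L` with the identity vanishes. -/
theorem torsion_eq_fnBracket_hor (L Γ : VectorOneForm E M) :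
    torsion L Γ = fnBracket L (hor Γ) := by
  have hΓ : ∀ Z, appHom Γ Z = appHom (hor Γ) Z + appHom (hor Γ) Z - Z := fun Z =>
    ContMDiffSection.ext fun z => by
      change Γ z (Z z) = (1 / 2 : ℝ) • (Z z + Γ z (Z z)) + (1 / 2 : ℝ) • (Z z + Γ z (Z z)) - Z z
      module
  funext X Y
  simp only [torsion, Pi.smul_apply, fnBracket_eq_endBracket, endBracket_apply, hΓ, map_add,
    map_sub, AddMonoidHom.add_apply, AddMonoidHom.sub_apply]
  module

theorem curvature_eq_zero_iff (Γ : VectorOneForm E M) :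
    curvature Γ = 0 ↔ fnBracket (hor Γ) (hor Γ) = 0 := by
  simp [curvature]

end Manifold

end LConn

theorem theorem9 {E : Type*} [NormedAddCommGroup E] [NormedSpace ℝ E] [FiniteDimensional ℝ E]
    {M : Type*} [TopologicalSpace M] [ChartedSpace E M] [IsManifold 𝓘(ℝ, E) ∞ M]
    [T2Space M] [ParacompactSpace M]
    (L Γ : LConn.VectorOneForm E M)
    (hL : LConn.IsAlmostTangent L) (hΓ : LConn.IsLConnection L Γ) :
    List.TFAE [
      LConn.fnBracket (LConn.almostComplex hL hΓ) (LConn.almostComplex hL hΓ) = 0,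
      LConn.torsion L Γ = 0 ∧ LConn.curvature Γ = 0,
      LConn.fnBracket L (LConn.almostComplex hL hΓ) = 0,
      LConn.fnBracket (LConn.hor Γ) (LConn.almostComplex hL hΓ) = 0] := by
  have hF := LConn.almostComplex_isAssociated hL hΓ
  have H := hL.isAdapted hΓ hF
  have hB : ∀ X Y, LConn.lieHom (LConn.appHom L X) (LConn.appHom L Y) =
      LConn.appHom L (LConn.lieHom (LConn.appHom L X) (LConn.appHom (LConn.hor Γ) Y)) +
        LConn.appHom L (LConn.lieHom (LConn.appHom (LConn.hor Γ) X) (LConn.appHom L Y)) := by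
    intro X Y
    -- As `Lh = L`, the identity for `L` may be applied to `hX` and `hY`, so that only mixed
    -- brackets appear on the right.
    rw [← H.L_h X, ← H.L_h Y]
    exact hL.lie_app_app _ _
  -- The rational structure serves only to permit cancelling the factor 2.
  have : Module ℚ (LConn.VectorField E M) := Module.compHom _ (algebraMap ℚ ℝ)
  have : IsAddTorsionFree (LConn.VectorField E M) := .of_module_rat _
  rw [LConn.torsion_eq_fnBracket_hor, LConn.curvature_eq_zero_iff]
  simp only [LConn.fnBracket_eq_zero_iff]
  rw [H.endBracket_self_eq_zero_iff _ hB, H.endBracket_L_h_and_h_h_eq_zero_iff _ hB,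
    H.endBracket_L_F_eq_zero_iff _ hB, H.endBracket_h_F_eq_zero_iff _ hB]
  -- All four entries are now literally (*).
  simp
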